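/- A composition of $n$ with $k$ parts is a sequence $\kappa=(\kappa_1,\dots,\kappa_k)$ of positive integers with sum $n$. For $n,k\ge 1$ let $\mathscr{C}^{(1)}[n,k]$ be the set of compositions of $n$ with exactly $k$ parts and rises at most $1$, that is, with $\kappa_{i+1}-\kappa_i\le 1$ for $1\le i<k$, and let $\sigma\mathscr{C}^{(1)}[n,k]$ be the set of those $\kappa\in\mathscr{C}^{(1)}[n,k]$ all of whose parts are at least $2$. Let $\widehat{\mathscr{C}^{(1)}}[n,k]$ be obtained from $\mathscr{C}^{(1)}[n,k]$ by removing the strictly decreasing compositions ($\kappa_1>\kappa_2>\dots>\kappa_k$) all of whose parts are congruent to $1$ or $4$ modulo $5$, and let $\widehat{\sigma\mathscr{C}^{(1)}}[n,k]$ be obtained from $\sigma\mathscr{C}^{(1)}[n,k]$ by removing the strictly decreasing compositions all of whose parts are congruent to $2$ or $3$ modulo $5$. Then $$\sum_{k=1}^n(-1)^k\,\bigl|\widehat{\mathscr{C}^{(1)}}[n,k]\bigr|=0\quad\text{for all } n\ge 1,$$ $$\sum_{k=1}^n(-1)^k\,\bigl|\widehat{\sigma\mathscr{C}^{(1)}}[n,k]\bigr|=0\quad\text{for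 all } n\ge 2.$$ -/

import Mathlib

/-- The composition `κ` has risings at most `m`: `κ_{i+1} - κ_i ≤ m` for all consecutive parts. -/
def RisingsAtMost (m : ℕ) {n : ℕ} (κ : Composition n) : Prop :=
  κ.blocks.IsChain (fun a b => b ≤ a + m)

/-- The composition `κ` is strictly decreasing: `κ_1 > κ_2 > ⋯`. -/
def IsStrictlyDecreasing {n : ℕ} (κ : Composition n) : Prop :=
  κ.blocks.IsChain (fun a b => b < a)

/-- Every part of `κ` is congruent to `r` or to `s` modulo `5`. -/
def PartsCongruentModFive (r s : ℕ) {n : ℕ} (κ : Composition n) : Prop :=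
  ∀ a ∈ κ.blocks, a ≡ r [MOD 5] ∨ a ≡ s [MOD 5]

instance (m n : ℕ) (κ : Composition n) : Decidable (RisingsAtMost m κ) := by
  unfold RisingsAtMost; infer_instance

instance (n : ℕ) (κ : Composition n) : Decidable (IsStrictlyDecreasing κ) := by
  unfold IsStrictlyDecreasing; infer_instance

instance (r s n : ℕ) (κ : Composition n) : Decidable (PartsCongruentModFive r s κ) := by
  unfold PartsCongruentModFive; infer_instance

/-- `𝒞⁽¹⁾[n, k]`: compositions of `n` with exactly `k` parts and risings at most `1`. -/
def compOne (n k : ℕ) : Finset (Composition n) :=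
  Finset.univ.filter fun κ => κ.length = k ∧ RisingsAtMost 1 κ

/-- `σ𝒞⁽¹⁾[n, k]`: the compositions in `𝒞⁽¹⁾[n, k]` all of whose parts are at least `2`. -/
def shiftCompOne (n k : ℕ) : Finset (Composition n) :=
  (compOne n k).filter fun κ => ∀ a ∈ κ.blocks, 2 ≤ a

/-- `𝒞⁽¹⁾[n, k]` without the strictly decreasing compositions whose parts are all
congruent to `1` or `4` modulo `5`. -/
def hatCompOne (n k : ℕ) : Finset (Composition n) :=
  (compOne n k).filter fun κ => ¬ (IsStrictlyDecreasing κ ∧ PartsCongruentModFive 1 4 κ)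

/-- `σ𝒞⁽¹⁾[n, k]` without the strictly decreasing compositions whose parts are all
congruent to `2` or `3` modulo `5`. -/
def hatShiftCompOne (n k : ℕ) : Finset (Composition n) :=
  (shiftCompOne n k).filter fun κ => ¬ (IsStrictlyDecreasing κ ∧ PartsCongruentModFive 2 3 κ)

/-! Let `F i` be the signed generating function, `(-1) ^ length`, of the compositions with rises at
most 1, parts at least `s + 1` and first part at most `i`. Splitting off a first part `i + 1` gives
`F i = F (i + 1) + x ^ (i + 1) * F (i + 2)`, with `F s = 1`. Ramanujan's series satisfies the same
recurrence (`ramanujanSum_rec`) and tends to the Euler product `(x; x)_∞`. Two solutions are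
proportional to their limits (`mul_eq_mul_of_rec`), so the limit of `F` is the Euler product divided
by the series at `s`. For `s = 0, 1` that series is a theta series, which the Jacobi triple product
factors over the residues 0, 2, 3 resp. 0, 1, 4 modulo 5. What remains is the product of `1 - x ^ a`
over `a` congruent to 1, 4 resp. 2, 3: the signed series of exactly the removed compositions.
Convergence is avoided by working modulo `X ^ K`, where `x` is nilpotent, limits are attained and
all factors `1 - x ^ a` with `a > 0` are units. -/

/-! ### Ramanujan's series and its recurrence. -/

section RamanujanSums

variable {R : Type*} [CommRing R]

/-- The shifted product `(1 - x ^ (n + 1)) ⋯ (1 - x ^ (n + i))`. -/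
def shiftedQFactorial (x : R) (n i : ℕ) : R :=
  ∏ j ∈ Finset.range i, (1 - x ^ (n + 1 + j))

theorem shiftedQFactorial_succ (x : R) (n i : ℕ) :
    shiftedQFactorial x n (i + 1) = (1 - x ^ (n + 1 + i)) * shiftedQFactorial x n i := by
  rw [shiftedQFactorial, Finset.prod_range_succ, mul_comm, shiftedQFactorial]

theorem shiftedQFactorial_succ' (x : R) (n i : ℕ) :
    shiftedQFactorial x n (i + 1) = (1 - x ^ (n + 1)) * shiftedQFactorial x (n + 1) i := by
  rw [shiftedQFactorial, Finset.prod_range_succ', mul_comm, shiftedQFactorial, add_zero]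
  congr 1
  exact Finset.prod_congr rfl fun j _ => by rw [show n + 1 + (j + 1) = n + 1 + 1 + j by ring]

/-- The partial sums of Ramanujan's series for `(q; q)_∞` times the generating function of the
partitions into parts larger than `i` with differences at least `2`. -/
def ramanujanSum (x : R) (N i : ℕ) : R :=
  ∑ n ∈ Finset.range N, (-1) ^ n * x ^ (2 * n * i + 5 * n.choose 2 + 3 * n) *
    (1 - x ^ (2 * i + 4 * n + 2)) * shiftedQFactorial x n i

/-- The partial sums of the companion of Ramanujan's series. -/
def ramanujanCompanionSum (x : R) (N i : ℕ) : R :=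
  ∑ n ∈ Finset.range N, (-1) ^ n * x ^ (2 * n * i + 5 * n.choose 2 + 4 * n) *
    (1 - x ^ (i + 2 * n + 1)) * shiftedQFactorial x n i

theorem choose_two_succ (n : ℕ) : (n + 1).choose 2 = n.choose 2 + n := by
  rw [Nat.choose_succ_succ' n 1, Nat.choose_one_right, add_comm]

/-- The combination telescopes term by term: splitting a shifted product of `i + 1` factors at its
last or its first factor turns each summand into a difference of consecutive boundary terms, and the
factor `1 - x ^ n` kills the one at `n = 0`. -/
theorem ramanujanSum_sub_companion (x : R) (N i : ℕ) :
    ramanujanSum x N i - ramanujanCompanionSum x N i -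
        x ^ (i + 1) * ramanujanCompanionSum x N (i + 1) =
      -((-1) ^ N * x ^ (2 * N * i + 5 * N.choose 2 + 3 * N) * (1 - x ^ N) *
        shiftedQFactorial x N i) := by
  have key := Finset.sum_range_sub' (fun n => (-1) ^ n *
    x ^ (2 * n * i + 5 * n.choose 2 + 3 * n) * (1 - x ^ n) * shiftedQFactorial x n i) N
  simp only [pow_zero, sub_self, mul_zero, zero_mul, zero_sub] at key
  rw [← key, ramanujanSum, ramanujanCompanionSum, ramanujanCompanionSum, Finset.mul_sum,
    ← Finset.sum_sub_distrib, ← Finset.sum_sub_distrib]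
  refine Finset.sum_congr rfl fun n _ => ?_
  have h1 := shiftedQFactorial_succ x n i
  have h2 := shiftedQFactorial_succ' x n i
  rw [choose_two_succ]
  linear_combination (-(-1) ^ n * x ^ (2 * n * i + 5 * n.choose 2 + 6 * n + i + 1)) * h1 +
    ((-1) ^ n * x ^ (2 * n * i + 5 * n.choose 2 + 8 * n + 2 * i + 3)) * h2

theorem ramanujanCompanionSum_sub (x : R) (N i : ℕ) :
    ramanujanCompanionSum x N i - ramanujanSum x N (i + 1) =
      -((-1) ^ N * x ^ (2 * N * i + 5 * N.choose 2 + 4 * N) * (1 - x ^ N) *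
        shiftedQFactorial x N i) := by
  have key := Finset.sum_range_sub' (fun n => (-1) ^ n *
    x ^ (2 * n * i + 5 * n.choose 2 + 4 * n) * (1 - x ^ n) * shiftedQFactorial x n i) N
  simp only [pow_zero, sub_self, mul_zero, zero_mul, zero_sub] at key
  rw [← key, ramanujanSum, ramanujanCompanionSum, ← Finset.sum_sub_distrib]
  refine Finset.sum_congr rfl fun n _ => ?_
  have h1 := shiftedQFactorial_succ x n i
  have h2 := shiftedQFactorial_succ' x n i
  rw [choose_two_succ]
  linear_combination (-(-1) ^ n * x ^ (2 * n * i + 5 * n.choose 2 + 5 * n)) * h1 +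
    ((-1) ^ n * x ^ (2 * n * i + 5 * n.choose 2 + 9 * n + 2 * i + 4)) * h2

/-- Eliminates the companion from the recurrence, and moves the value at 1 to index 0, where the
shifted products are empty. -/
theorem ramanujanCompanionSum_eq {x : R} {N : ℕ} (hx : x ^ N = 0) (i : ℕ) :
    ramanujanCompanionSum x N i = ramanujanSum x N (i + 1) := by
  rw [← sub_eq_zero, ramanujanCompanionSum_sub, pow_eq_zero_of_le (by lia) hx]
  ring

theorem ramanujanSum_rec {x : R} {N : ℕ} (hx : x ^ N = 0) (i : ℕ) :
    ramanujanSum x N i = ramanujanSum x N (i + 1) + x ^ (i + 1) * ramanujanSum x N (i + 2) := by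
  have h := ramanujanSum_sub_companion x N i
  rw [pow_eq_zero_of_le (n := 2 * N * i + _ + _) (by lia) hx, ramanujanCompanionSum_eq hx,
    ramanujanCompanionSum_eq hx] at h
  linear_combination h

theorem ramanujanSum_eq_qFactorial {x : R} {N i : ℕ} (hN : 0 < N) (hx : x ^ N = 0) (hi : N ≤ i) :
    ramanujanSum x N i = ∏ j ∈ Finset.range i, (1 - x ^ (j + 1)) := by
  rw [ramanujanSum, Finset.sum_eq_single_of_mem 0 (Finset.mem_range.2 hN)]
  · rw [pow_eq_zero_of_le (n := 2 * i + 4 * 0 + 2) (by lia) hx, shiftedQFactorial]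
    simp [add_comm]
  · intro n _ hn
    have : i ≤ n * i := Nat.le_mul_of_pos_left i (Nat.pos_of_ne_zero hn)
    rw [pow_eq_zero_of_le (n := 2 * n * i + _ + _) (by nlinarith) hx]
    ring

/-- Two solutions of `f i = f (i + 1) + x ^ (i + 1) * f (i + 2)` are proportional to their limits. -/
theorem mul_eq_mul_of_rec {x : R} {N : ℕ} (hx : x ^ N = 0) {f g : ℕ → R} {s : ℕ}
    (hf : ∀ i, s ≤ i → f i = f (i + 1) + x ^ (i + 1) * f (i + 2))
    (hg : ∀ i, s ≤ i → g i = g (i + 1) + x ^ (i + 1) * g (i + 2))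
    {m : ℕ} (hm : N ≤ m) (hs : s ≤ m) : f s * g m = g s * f m := by
  have hfm : f m = f (m + 1) := by
    rw [hf m hs, pow_eq_zero_of_le (by lia) hx, zero_mul, add_zero]
  have hgm : g m = g (m + 1) := by
    rw [hg m hs, pow_eq_zero_of_le (by lia) hx, zero_mul, add_zero]
  -- Descending induction from `m`, where both solutions agree with their next value; the recurrence
  -- has order two, so two consecutive values are carried.
  have key : ∀ k, k ≤ m - s → f (m - k) * g m = g (m - k) * f m ∧
      f (m - k + 1) * g m = g (m - k + 1) * f m := by
    intro k
    induction k with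
    | zero => intro _; simp only [Nat.sub_zero, ← hfm, ← hgm]; simp [mul_comm]
    | succ k ih =>
      intro hk
      obtain ⟨h1, h2⟩ := ih (by lia)
      have e : m - k = m - (k + 1) + 1 := by lia
      rw [e] at h1 h2
      refine ⟨?_, h1⟩
      rw [hf (m - (k + 1)) (by lia), hg (m - (k + 1)) (by lia)]
      linear_combination h1 + x ^ (m - (k + 1) + 1) * h2
  have h := (key (m - s) le_rfl).1
  rwa [Nat.sub_sub_self hs] at h

end RamanujanSums

/-! ### The Jacobi triple product from the `q`-binomial theorem. -/

section TripleProduct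

variable {R : Type*} [CommRing R]

/-- The Gaussian binomial coefficient. -/
def gaussBinom (q : R) : ℕ → ℕ → R
  | _, 0 => 1
  | 0, _ + 1 => 0
  | n + 1, k + 1 => gaussBinom q n k + q ^ (k + 1) * gaussBinom q n (k + 1)

@[simp]
theorem gaussBinom_zero_right (q : R) (n : ℕ) : gaussBinom q n 0 = 1 := by
  cases n <;> rfl

theorem gaussBinom_succ_succ (q : R) (n k : ℕ) :
    gaussBinom q (n + 1) (k + 1) = gaussBinom q n k + q ^ (k + 1) * gaussBinom q n (k + 1) := rfl

theorem gaussBinom_eq_zero_of_lt (q : R) : ∀ {n k : ℕ}, n < k → gaussBinom q n k = 0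
  | 0, _ + 1, _ => rfl
  | n + 1, k + 1, h => by
    rw [gaussBinom_succ_succ, gaussBinom_eq_zero_of_lt q (by lia : n < k),
      gaussBinom_eq_zero_of_lt q (by lia : n < k + 1)]
    ring

theorem map_gaussBinom {S : Type*} [CommRing S] (f : R →+* S) (q : R) :
    ∀ n k : ℕ, f (gaussBinom q n k) = gaussBinom (f q) n k
  | n, 0 => by simp
  | 0, k + 1 => by simp [gaussBinom]
  | n + 1, k + 1 => by
    simp [gaussBinom_succ_succ, map_gaussBinom f q n k, map_gaussBinom f q n (k + 1)]

/-- The product `(1 - q) ⋯ (1 - q ^ n)`. -/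
def qFactorial (q : R) (n : ℕ) : R := ∏ j ∈ Finset.range n, (1 - q ^ (j + 1))

theorem qFactorial_succ (q : R) (n : ℕ) :
    qFactorial q (n + 1) = qFactorial q n * (1 - q ^ (n + 1)) :=
  Finset.prod_range_succ _ _

theorem gaussBinom_mul_qFactorial (q : R) (m k : ℕ) :
    gaussBinom q (k + m) k * qFactorial q k * qFactorial q m = qFactorial q (k + m) := by
  induction k generalizing m with
  | zero => simp [qFactorial]
  | succ k ihk =>
    induction m with
    | zero =>
      have h := ihk 0
      rw [add_zero] at h
      rw [add_zero, gaussBinom_succ_succ, gaussBinom_eq_zero_of_lt q (Nat.lt_succ_self k),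
        qFactorial_succ]
      linear_combination (1 - q ^ (k + 1)) * h
    | succ m ihm =>
      have h1 := ihk (m + 1)
      rw [show k + 1 + (m + 1) = k + (m + 1) + 1 by ring, gaussBinom_succ_succ,
        qFactorial_succ q (k + (m + 1)), ← h1]
      rw [show k + 1 + m = k + (m + 1) by ring, ← h1] at ihm
      rw [qFactorial_succ q k, qFactorial_succ q m] at *
      linear_combination q ^ (k + 1) * (1 - q ^ (m + 1)) * ihm

/-- The `q`-binomial theorem. -/
theorem prod_add_mul_pow_eq_sum (q a b : R) (n : ℕ) :
    ∏ i ∈ Finset.range n, (a + b * q ^ i) =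
      ∑ k ∈ Finset.range (n + 1), q ^ k.choose 2 * gaussBinom q n k * a ^ (n - k) * b ^ k := by
  induction n generalizing b with
  | zero => simp
  | succ n ih =>
    rw [Finset.prod_range_succ']
    have h : ∏ i ∈ Finset.range n, (a + b * q ^ (i + 1)) =
        ∏ i ∈ Finset.range n, (a + b * q * q ^ i) :=
      Finset.prod_congr rfl fun i _ => by ring
    rw [h, ih, pow_zero, mul_one, mul_add]
    have h1 : (∑ k ∈ Finset.range (n + 1),
          q ^ k.choose 2 * gaussBinom q n k * a ^ (n - k) * (b * q) ^ k) * a =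
        ∑ k ∈ Finset.range (n + 2),
          q ^ k.choose 2 * (q ^ k * gaussBinom q n k) * a ^ (n + 1 - k) * b ^ k := by
      rw [Finset.sum_range_succ _ (n + 1), gaussBinom_eq_zero_of_lt q (Nat.lt_succ_self n),
        Finset.sum_mul]
      simp only [mul_zero, zero_mul, add_zero]
      refine Finset.sum_congr rfl fun k hk => ?_
      rw [Nat.sub_add_comm (Nat.lt_succ_iff.1 (Finset.mem_range.1 hk))]
      ring
    rw [h1, Finset.sum_range_succ' _ (n + 1), Finset.sum_range_succ' _ (n + 1), Finset.sum_mul,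
      add_right_comm, ← Finset.sum_add_distrib]
    congr 1
    · refine Finset.sum_congr rfl fun k _ => ?_
      rw [gaussBinom_succ_succ, choose_two_succ, Nat.add_sub_add_right]
      ring
    · simp

/-- The terms of the theta series in the variables `u` and `v`, with the index shifted by `N`. -/
def thetaTerm (u v : R) (N k : ℕ) : R :=
  if N ≤ k then (u * v) ^ (k - N).choose 2 * u ^ (k - N)
  else (u * v) ^ (N - k).choose 2 * v ^ (N - k)

theorem choose_two_add (m n : ℕ) : (m + n).choose 2 = m.choose 2 + n.choose 2 + m * n := by
  induction n with
  | zero => simp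
  | succ n ih => rw [← add_assoc, choose_two_succ, choose_two_succ, ih]; ring

theorem two_mul_choose_two_add (n : ℕ) : 2 * n.choose 2 + n = n * n := by
  induction n with
  | zero => rfl
  | succ n ih => rw [choose_two_succ]; linear_combination ih

/-- Matches a theta term with a term of the `q`-binomial expansion; the monomial prefactor clears
the denominators. -/
theorem thetaTerm_mul (u v : R) {M k : ℕ} (hk : k ≤ 2 * (M + 1)) :
    v ^ (M + 1) * (u * v) ^ (3 * (M + 1).choose 2) * thetaTerm u v (M + 1) k =
      (u * v) ^ k.choose 2 * (v * (u * v) ^ M) ^ (2 * (M + 1) - k) := by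
  have hM := two_mul_choose_two_add (M + 1)
  unfold thetaTerm
  split_ifs with h
  · obtain ⟨n, rfl⟩ := Nat.exists_eq_add_of_le h
    obtain ⟨p, hp⟩ := Nat.exists_eq_add_of_le (show n ≤ M + 1 by lia)
    rw [Nat.add_sub_cancel_left, show 2 * (M + 1) - (M + 1 + n) = p by lia,
      choose_two_add (M + 1) n]
    have e : 3 * (M + 1).choose 2 + n.choose 2 + n =
        (M + 1).choose 2 + n.choose 2 + (M + 1) * n + M * p := by
      zify at *
      have h2 : (p : ℤ) = M + 1 - n := by lia
      rw [h2]
      linear_combination hM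
    have e2 : (v * (u * v) ^ M) ^ p = v ^ p * (u * v) ^ (M * p) := by rw [mul_pow, ← pow_mul]
    rw [e2]
    clear e2 hM
    generalize (M + 1).choose 2 = T at *
    calc _ = v ^ p * (u * v) ^ (3 * T + n.choose 2 + n) := by rw [hp]; ring
      _ = _ := by rw [e]; ring
  · obtain ⟨n, hn⟩ := Nat.exists_eq_add_of_le (show k ≤ M + 1 by lia)
    rw [show M + 1 - k = n by lia, show 2 * (M + 1) - k = M + 1 + n by lia]
    have e : 3 * (M + 1).choose 2 + n.choose 2 = k.choose 2 + M * (M + 1 + n) := by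
      have h1 := choose_two_add k n
      rw [← hn] at h1
      have h3 := two_mul_choose_two_add n
      zify at *
      have h2 : (k : ℤ) = M + 1 - n := by lia
      rw [h2] at h1
      linear_combination hM + h1 + h3
    have e2 : (v * (u * v) ^ M) ^ (M + 1 + n) = v ^ (M + 1 + n) * (u * v) ^ (M * (M + 1 + n)) := by
      rw [mul_pow, ← pow_mul]
    rw [e2]
    clear e2 hM
    generalize (M + 1).choose 2 = T at *
    calc _ = v ^ (M + 1 + n) * (u * v) ^ (3 * T + n.choose 2) := by ring
      _ = _ := by rw [e]; ring

/-- The finite form of the Jacobi triple product identity, in a domain. -/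
theorem prod_eq_sum_thetaTerm_of_isDomain [IsDomain R] {u v : R} (hu : u ≠ 0) (hv : v ≠ 0)
    (M : ℕ) :
    ∏ j ∈ Finset.range (M + 1), ((1 - u * (u * v) ^ j) * (1 - v * (u * v) ^ j)) =
      ∑ k ∈ Finset.range (2 * (M + 1) + 1),
        (-1) ^ (M + 1 + k) * gaussBinom (u * v) (2 * (M + 1)) k * thetaTerm u v (M + 1) k := by
  have hne : v ^ (M + 1) * (u * v) ^ (3 * (M + 1).choose 2) ≠ 0 :=
    mul_ne_zero (pow_ne_zero _ hv) (pow_ne_zero _ (mul_ne_zero hu hv))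
  have hM : 2 * (M + 1).choose 2 = M * (M + 1) := by
    linear_combination two_mul_choose_two_add (M + 1)
  apply mul_left_cancel₀ hne
  -- Up to monomials, the first `M + 1` factors are the `1 - v * (u * v) ^ j` in reverse order, and
  -- the last `M + 1` are the `1 - u * (u * v) ^ j`.
  have key := prod_add_mul_pow_eq_sum (u * v) (v * (u * v) ^ M) (-1) (2 * (M + 1))
  have hprod : ∏ i ∈ Finset.range (2 * (M + 1)), (v * (u * v) ^ M + -1 * (u * v) ^ i) =
      (-1) ^ (M + 1) * (v ^ (M + 1) * (u * v) ^ (3 * (M + 1).choose 2) *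
        ∏ j ∈ Finset.range (M + 1), ((1 - u * (u * v) ^ j) * (1 - v * (u * v) ^ j))) := by
    rw [two_mul, Finset.prod_range_add, ← Finset.prod_range_reflect]
    have h1 : ∀ j ∈ Finset.range (M + 1),
        v * (u * v) ^ M + -1 * (u * v) ^ (M + 1 - 1 - j) =
          (-1) * (u * v) ^ (M - j) * (1 - v * (u * v) ^ j) := by
      intro j hj
      have hj' : M - j + j = M := by have := Finset.mem_range.1 hj; lia
      rw [Nat.add_sub_cancel]
      nth_rewrite 1 [← hj']
      ring
    have h2 : ∀ j ∈ Finset.range (M + 1), v * (u * v) ^ M + -1 * (u * v) ^ (M + 1 + j) =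
        (v * (u * v) ^ M) * (1 - u * (u * v) ^ j) := fun j _ => by ring
    rw [Finset.prod_congr rfl h1, Finset.prod_congr rfl h2]
    simp only [Finset.prod_mul_distrib, Finset.prod_const, Finset.card_range]
    have h3 : ∏ j ∈ Finset.range (M + 1), (u * v) ^ (M - j) = (u * v) ^ (M + 1).choose 2 := by
      have := Finset.prod_range_reflect (fun j => (u * v) ^ j) (M + 1)
      rw [Nat.add_sub_cancel] at this
      rw [this, Finset.prod_pow_eq_pow_sum, Finset.sum_range_id, Nat.choose_two_right]
    rw [h3, ← pow_mul, show 3 * (M + 1).choose 2 = (M + 1).choose 2 + M * (M + 1) by lia]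
    ring
  rw [hprod] at key
  have hsq : ((-1 : R) ^ (M + 1)) * (-1) ^ (M + 1) = 1 := by rw [← mul_pow]; simp
  have hcancel : ∀ {a b : R}, (-1) ^ (M + 1) * a = b → a = (-1) ^ (M + 1) * b := fun h => by
    rw [← h, ← mul_assoc, hsq, one_mul]
  rw [hcancel key, Finset.mul_sum, Finset.mul_sum]
  refine Finset.sum_congr rfl fun k hk => ?_
  have := thetaTerm_mul u v (Nat.lt_succ_iff.1 (Finset.mem_range.1 hk))
  linear_combination (-(-1) ^ (M + 1 + k) * gaussBinom (u * v) (2 * (M + 1)) k) * this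

theorem map_thetaTerm {S : Type*} [CommRing S] (f : R →+* S) (u v : R) (N k : ℕ) :
    f (thetaTerm u v N k) = thetaTerm (f u) (f v) N k := by
  unfold thetaTerm
  split_ifs <;> simp

/-- The finite form of the Jacobi triple product identity for powers of one element. -/
theorem prod_eq_sum_thetaTerm (x : R) (c d M : ℕ) :
    ∏ j ∈ Finset.range (M + 1),
        ((1 - x ^ c * (x ^ c * x ^ d) ^ j) * (1 - x ^ d * (x ^ c * x ^ d) ^ j)) =
      ∑ k ∈ Finset.range (2 * (M + 1) + 1), (-1) ^ (M + 1 + k) *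
        gaussBinom (x ^ c * x ^ d) (2 * (M + 1)) k * thetaTerm (x ^ c) (x ^ d) (M + 1) k := by
  -- Monomials in a nilpotent `x` cannot be cancelled, so the identity is specialised from `ℤ[X]`.
  have h := congrArg (Polynomial.eval₂RingHom (Int.castRingHom R) x)
    (prod_eq_sum_thetaTerm_of_isDomain (R := Polynomial ℤ)
      (pow_ne_zero c Polynomial.X_ne_zero) (pow_ne_zero d Polynomial.X_ne_zero) M)
  simpa only [map_prod, map_sum, map_mul, map_sub, map_one, map_pow, map_neg, map_gaussBinom,
    map_thetaTerm, Polynomial.coe_eval₂RingHom, Polynomial.eval₂_X] using h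

theorem isUnit_one_sub_pow {x : R} {K : ℕ} (hx : x ^ K = 0) {n : ℕ} (hn : 0 < n) :
    IsUnit (1 - x ^ n) :=
  IsNilpotent.isUnit_one_sub ((show IsNilpotent x from ⟨K, hx⟩).pow_of_pos hn.ne')

theorem isUnit_qFactorial {x : R} {K : ℕ} (hx : x ^ K = 0) (n : ℕ) : IsUnit (qFactorial x n) :=
  IsUnit.prod_iff.2 fun _ _ => isUnit_one_sub_pow hx (Nat.succ_pos _)

theorem qFactorial_eq_of_le {x : R} {K : ℕ} (hx : x ^ K = 0) {n : ℕ} (hn : K ≤ n) :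
    qFactorial x n = qFactorial x K := by
  induction n, hn using Nat.le_induction with
  | base => rfl
  | succ n hn ih => rw [qFactorial_succ, ih, pow_eq_zero_of_le (by lia) hx, sub_zero, mul_one]

theorem gaussBinom_mul_qFactorial_eq_one {x : R} {K : ℕ} (hx : x ^ K = 0) {k m : ℕ}
    (hk : K ≤ k) (hm : K ≤ m) : gaussBinom x (k + m) k * qFactorial x K = 1 := by
  have h := gaussBinom_mul_qFactorial x m k
  rw [qFactorial_eq_of_le hx hk, qFactorial_eq_of_le hx hm,
    qFactorial_eq_of_le hx (by lia : K ≤ k + m)] at h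
  exact (isUnit_qFactorial hx K).mul_right_cancel (by rw [h, one_mul])

theorem sum_neg_one_pow_mul_thetaTerm (u v : R) (N : ℕ) :
    ∑ k ∈ Finset.range (2 * N + 1), (-1) ^ (N + k) * thetaTerm u v N k =
      (∑ n ∈ Finset.range (N + 1), (-1) ^ n * ((u * v) ^ n.choose 2 * u ^ n)) -
        ∑ n ∈ Finset.range N, (-1) ^ n * ((u * v) ^ (n + 1).choose 2 * v ^ (n + 1)) := by
  have hsq : ((-1 : R) ^ N) * (-1) ^ N = 1 := by rw [← mul_pow]; simp
  rw [show 2 * N + 1 = N + (N + 1) by ring, Finset.sum_range_add, ← Finset.sum_range_reflect,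
    add_comm, sub_eq_add_neg, ← Finset.sum_neg_distrib]
  congr 1
  · refine Finset.sum_congr rfl fun n _ => ?_
    rw [thetaTerm, if_pos (Nat.le_add_right N n), Nat.add_sub_cancel_left]
    linear_combination ((-1) ^ n * ((u * v) ^ n.choose 2 * u ^ n)) * hsq
  · refine Finset.sum_congr rfl fun n hn => ?_
    have hn := Finset.mem_range.1 hn
    rw [thetaTerm, if_neg (by lia), show N - (N - 1 - n) = n + 1 by lia]
    have : (-1 : R) ^ (N + (N - 1 - n)) = -(-1) ^ n := by
      have e : N + (N - 1 - n) + (n + 1) = N + N := by lia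
      have h2 : (-1 : R) ^ (N + (N - 1 - n)) * (-1) ^ (n + 1) = 1 := by
        rw [← pow_add, e, pow_add, hsq]
      have h3 : ((-1 : R) ^ n) * (-1) ^ n = 1 := by rw [← mul_pow]; simp
      rw [pow_succ] at h2
      linear_combination (-(-1) ^ n) * h2 - (-1 : R) ^ (N + (N - 1 - n)) * h3
    rw [this]
    ring

/-- The Jacobi triple product identity for powers of a nilpotent element. -/
theorem triple_product_of_pow_eq_zero {x : R} {K : ℕ} (hK : 0 < K) (hx : x ^ K = 0) {c d : ℕ}
    (hc : 0 < c) (hd : 0 < d) :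
    ∑ n ∈ Finset.range (2 * K), (-1) ^ n * (x ^ ((c + d) * n.choose 2 + c * n) -
        x ^ ((c + d) * (n + 1).choose 2 + d * (n + 1))) =
      ∏ j ∈ Finset.range (2 * K), ((1 - x ^ ((c + d) * j + c)) * (1 - x ^ ((c + d) * j + d)) *
        (1 - x ^ ((c + d) * j + (c + d)))) := by
  obtain ⟨M, hM⟩ : ∃ M, 2 * K = M + 1 := ⟨2 * K - 1, by lia⟩
  set q := x ^ (c + d) with hq
  have hqK : q ^ K = 0 := by
    rw [hq, ← pow_mul]; exact pow_eq_zero_of_le (Nat.le_mul_of_pos_left K (by lia)) hx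
  have hprod : ∏ j ∈ Finset.range (2 * K), ((1 - x ^ ((c + d) * j + c)) *
      (1 - x ^ ((c + d) * j + d)) * (1 - x ^ ((c + d) * j + (c + d)))) =
      (∏ j ∈ Finset.range (2 * K),
        ((1 - x ^ c * (x ^ c * x ^ d) ^ j) * (1 - x ^ d * (x ^ c * x ^ d) ^ j))) *
        qFactorial q K := by
    rw [← qFactorial_eq_of_le hqK (by lia : K ≤ 2 * K), qFactorial, ← Finset.prod_mul_distrib]
    refine Finset.prod_congr rfl fun j _ => ?_
    rw [hq]
    ring
  rw [hprod, hM, prod_eq_sum_thetaTerm, ← hM, Finset.sum_mul, ← pow_add, ← hq]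
  have hterm : ∀ k ∈ Finset.range (2 * (2 * K) + 1), (-1) ^ (2 * K + k) *
      gaussBinom q (2 * (2 * K)) k * thetaTerm (x ^ c) (x ^ d) (2 * K) k * qFactorial q K =
      (-1) ^ (2 * K + k) * thetaTerm (x ^ c) (x ^ d) (2 * K) k := by
    intro k hk
    have hk := Finset.mem_range.1 hk
    -- In the middle range both `k` and `4 * K - k` are at least `K`, so the Gaussian binomial is
    -- inverse to `qFactorial q K`; outside it, `k` is more than `K` away from the centre `2 * K`
    -- and the theta term vanishes.
    by_cases h : K ≤ k ∧ k ≤ 3 * K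
    · have := gaussBinom_mul_qFactorial_eq_one hqK h.1 (by lia : K ≤ 4 * K - k)
      rw [show k + (4 * K - k) = 2 * (2 * K) by lia] at this
      linear_combination ((-1) ^ (2 * K + k) * thetaTerm (x ^ c) (x ^ d) (2 * K) k) * this
    · have h0 : thetaTerm (x ^ c) (x ^ d) (2 * K) k = 0 := by
        unfold thetaTerm
        split_ifs with h'
        · rw [← pow_mul x c, pow_eq_zero_of_le (n := c * (k - 2 * K)) _ hx, mul_zero]
          exact (by lia : K ≤ k - 2 * K).trans (Nat.le_mul_of_pos_left _ hc)
        · rw [← pow_mul x d, pow_eq_zero_of_le (n := d * (2 * K - k)) _ hx, mul_zero]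
          exact (by lia : K ≤ 2 * K - k).trans (Nat.le_mul_of_pos_left _ hd)
      rw [h0]; ring
  rw [Finset.sum_congr rfl hterm, sum_neg_one_pow_mul_thetaTerm, Finset.sum_range_succ,
    ← pow_mul x c (2 * K), pow_eq_zero_of_le (n := c * (2 * K)) _ hx, mul_zero, mul_zero, add_zero,
    ← Finset.sum_sub_distrib]
  · refine Finset.sum_congr rfl fun n _ => ?_
    ring
  · exact (by lia : K ≤ 2 * K).trans (Nat.le_mul_of_pos_left _ hc)

end TripleProduct

/-! ### Signed generating functions of compositions with restricted successors. -/

section WordSeries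

/-- The words with letters in `S`, first letter less than `m`, and in which every letter `a` is
followed by a letter less than `t a`. -/
def IsBoundedWord (S : ℕ → Prop) (t : ℕ → ℕ) (m : ℕ) (l : List ℕ) : Prop :=
  (∀ a ∈ l, S a) ∧ l.IsChain (fun a b => b < t a) ∧ ∀ a ∈ l.head?, a < m

theorem isBoundedWord_cons {S : ℕ → Prop} {t : ℕ → ℕ} {m a : ℕ} {l : List ℕ} :
    IsBoundedWord S t m (a :: l) ↔ S a ∧ a < m ∧ IsBoundedWord S t (t a) l := by
  simp only [IsBoundedWord, List.forall_mem_cons, List.isChain_cons, List.head?_cons,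
    Option.mem_some_iff, forall_eq']
  tauto

theorem isBoundedWord_iff_of_forall_lt {S : ℕ → Prop} {t : ℕ → ℕ} {m : ℕ} {l : List ℕ}
    (h : ∀ a ∈ l, a < m) :
    IsBoundedWord S t m l ↔ (∀ a ∈ l, S a) ∧ l.IsChain (fun a b => b < t a) := by
  rw [IsBoundedWord, ← and_assoc, and_iff_left]
  exact fun a ha => h a (List.mem_of_mem_head? ha)

theorem isBoundedWord_succ_and_head?_ne {S : ℕ → Prop} {t : ℕ → ℕ} {m : ℕ} {l : List ℕ} :
    (IsBoundedWord S t (m + 1) l ∧ ¬ l.head? = some m) ↔ IsBoundedWord S t m l := by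
  cases l with
  | nil => simp [IsBoundedWord]
  | cons a l =>
    simp only [isBoundedWord_cons, List.head?_cons, Option.some.injEq]
    constructor
    · rintro ⟨⟨h1, h2, h3⟩, h4⟩
      exact ⟨h1, by lia, h3⟩
    · rintro ⟨h1, h2, h3⟩
      exact ⟨⟨h1, by lia, h3⟩, by lia⟩

open Classical in
/-- The generating function of the compositions whose blocks are a bounded word, signed by the
parity of the length. -/
noncomputable def wordSeries (S : ℕ → Prop) (t : ℕ → ℕ) (m : ℕ) : PowerSeries ℤ :=
  PowerSeries.mk fun n => ∑ κ : Composition n with IsBoundedWord S t m κ.blocks, (-1) ^ κ.length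

open Classical in
theorem sum_isBoundedWord_head?_eq {S : ℕ → Prop} {t : ℕ → ℕ} {m : ℕ} (hm : 0 < m) (hS : S m)
    {n : ℕ} (hn : m ≤ n) :
    ∑ κ : Composition n with IsBoundedWord S t (m + 1) κ.blocks ∧ κ.blocks.head? = some m,
        (-1 : ℤ) ^ κ.length =
      -∑ κ : Composition (n - m) with IsBoundedWord S t (t m) κ.blocks, (-1) ^ κ.length := by
  rw [← Finset.sum_neg_distrib]
  symm
  refine Finset.sum_nbij (fun κ => ⟨m :: κ.blocks, ?_, ?_⟩) ?_ ?_ ?_ ?_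
  · intro i hi
    rcases List.mem_cons.1 hi with rfl | hi
    exacts [hm, κ.blocks_pos hi]
  · rw [List.sum_cons, κ.blocks_sum]; lia
  · intro κ hκ
    simpa [isBoundedWord_cons, hS] using hκ
  · intro κ _ κ' _ h
    simpa [Composition.ext_iff] using h
  · rintro ⟨l, hpos, hsum⟩ hκ
    cases l with
    | nil => simp at hκ
    | cons a l =>
      simp only [Finset.coe_filter, Finset.mem_univ, true_and, Set.mem_ofPred_eq,
        List.head?_cons, Option.some.injEq, isBoundedWord_cons] at hκ
      obtain ⟨⟨_, _, h⟩, rfl⟩ := hκ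
      refine ⟨⟨l, fun hi => hpos (List.mem_cons_of_mem _ hi), ?_⟩, by simpa using h, rfl⟩
      rw [List.sum_cons] at hsum
      lia
  · intro κ _
    simp [Composition.length, pow_succ]

open Classical in
theorem coeff_wordSeries_succ (S : ℕ → Prop) (t : ℕ → ℕ) (m n : ℕ) :
    PowerSeries.coeff n (wordSeries S t (m + 1)) = PowerSeries.coeff n (wordSeries S t m) +
      ∑ κ : Composition n with IsBoundedWord S t (m + 1) κ.blocks ∧ κ.blocks.head? = some m,
        (-1 : ℤ) ^ κ.length := by
  simp only [wordSeries, PowerSeries.coeff_mk]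
  rw [← Finset.sum_filter_add_sum_filter_not _ (fun κ => κ.blocks.head? = some m), add_comm]
  simp only [Finset.filter_filter, isBoundedWord_succ_and_head?_ne]

/-- The new words start with `m`; deleting it flips the sign, lowers the sum by `m` and leaves a
word bounded by `t m`. -/
theorem wordSeries_succ_of_mem {S : ℕ → Prop} (t : ℕ → ℕ) {m : ℕ} (hm : 0 < m) (hS : S m) :
    wordSeries S t (m + 1) = wordSeries S t m - PowerSeries.X ^ m * wordSeries S t (t m) := by
  classical
  ext n
  rw [coeff_wordSeries_succ, map_sub, PowerSeries.coeff_X_pow_mul', sub_eq_add_neg]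
  congr 1
  split_ifs with h
  · rw [sum_isBoundedWord_head?_eq hm hS h, wordSeries, PowerSeries.coeff_mk]
  · rw [neg_zero]
    refine Finset.sum_eq_zero fun κ hκ => absurd ?_ h
    exact κ.blocks_le (List.mem_of_mem_head? (Finset.mem_filter.1 hκ).2.2)

theorem wordSeries_succ_of_not_mem {S : ℕ → Prop} (t : ℕ → ℕ) {m : ℕ} (hS : ¬ S m) :
    wordSeries S t (m + 1) = wordSeries S t m := by
  classical
  ext n
  rw [coeff_wordSeries_succ, add_eq_left]
  refine Finset.sum_eq_zero fun κ hκ => absurd ?_ hS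
  obtain ⟨_, hκ, h⟩ := Finset.mem_filter.1 hκ
  exact hκ.1 m (List.mem_of_mem_head? h)

theorem wordSeries_zero (S : ℕ → Prop) (t : ℕ → ℕ) : wordSeries S t 0 = 1 := by
  classical
  have hw : ∀ {n : ℕ} (κ : Composition n), IsBoundedWord S t 0 κ.blocks ↔ n = 0 := by
    intro n κ
    rw [← κ.blocks_eq_nil]
    cases κ.blocks <;> simp [IsBoundedWord]
  ext n
  rw [wordSeries, PowerSeries.coeff_mk, PowerSeries.coeff_one]
  simp only [hw]
  split_ifs with h
  · subst h
    simp [Composition.length, (Composition.blocks_eq_nil _).2, composition_card]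
  · simp [h]

/-- For `t = id` the words are strictly decreasing, so each letter of `S` is used at most once. -/
theorem wordSeries_id_eq_prod {S : ℕ → Prop} [DecidablePred S] (hS : ∀ a, S a → 0 < a) (m : ℕ) :
    wordSeries S id m =
      ∏ a ∈ Finset.range m, if S a then 1 - (PowerSeries.X : PowerSeries ℤ) ^ a else 1 := by
  induction m with
  | zero => simp [wordSeries_zero]
  | succ m ih =>
    rw [Finset.prod_range_succ, ← ih]
    split_ifs with h
    · rw [wordSeries_succ_of_mem id (hS m h) h, id]; ring
    · rw [wordSeries_succ_of_not_mem id h, mul_one]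

theorem coeff_wordSeries_of_lt {S : ℕ → Prop} {t : ℕ → ℕ} {n m : ℕ} (h : n < m)
    {P : Composition n → Prop} [DecidablePred P] (hP : ∀ κ, P κ ↔
      (∀ a ∈ κ.blocks, S a) ∧ κ.blocks.IsChain (fun a b => b < t a)) :
    PowerSeries.coeff n (wordSeries S t m) = ∑ κ : Composition n with P κ, (-1) ^ κ.length := by
  classical
  rw [wordSeries, PowerSeries.coeff_mk]
  refine Finset.sum_congr (Finset.filter_congr fun κ _ => ?_) fun _ _ => rfl
  rw [hP, isBoundedWord_iff_of_forall_lt fun a ha => (κ.blocks_le ha).trans_lt h]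

end WordSeries

/-! ### Product formulas modulo 5. -/

section RogersRamanujan

variable {R : Type*} [CommRing R]

theorem ramanujanSum_zero_eq_prod {x : R} {K : ℕ} (hK : 0 < K) (hx : x ^ K = 0) :
    ramanujanSum x (2 * K) 0 = ∏ j ∈ Finset.range (2 * K),
      ((1 - x ^ (5 * j + 3)) * (1 - x ^ (5 * j + 2)) * (1 - x ^ (5 * j + 5))) := by
  rw [← triple_product_of_pow_eq_zero hK hx (c := 3) (d := 2) (by lia) (by lia), ramanujanSum]
  refine Finset.sum_congr rfl fun n _ => ?_
  rw [choose_two_succ, shiftedQFactorial, Finset.prod_range_zero]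
  ring

theorem ramanujanSum_one_eq_prod {x : R} {K : ℕ} (hK : 0 < K) (hx : x ^ K = 0) :
    ramanujanSum x (2 * K) 1 = ∏ j ∈ Finset.range (2 * K),
      ((1 - x ^ (5 * j + 4)) * (1 - x ^ (5 * j + 1)) * (1 - x ^ (5 * j + 5))) := by
  rw [← triple_product_of_pow_eq_zero hK hx (c := 4) (d := 1) (by lia) (by lia),
    ← ramanujanCompanionSum_eq (pow_eq_zero_of_le (by lia) hx), ramanujanCompanionSum]
  refine Finset.sum_congr rfl fun n _ => ?_
  rw [choose_two_succ, shiftedQFactorial, Finset.prod_range_zero]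
  ring

theorem prod_range_five_mul (x : R) (M : ℕ) :
    ∏ j ∈ Finset.range (5 * M), (1 - x ^ (j + 1)) =
      ∏ j ∈ Finset.range M, ((1 - x ^ (5 * j + 1)) * (1 - x ^ (5 * j + 2)) *
        (1 - x ^ (5 * j + 3)) * (1 - x ^ (5 * j + 4)) * (1 - x ^ (5 * j + 5))) := by
  induction M with
  | zero => simp
  | succ M ih =>
    rw [Finset.prod_range_succ _ M, ← ih, show 5 * (M + 1) = 5 * M + 1 + 1 + 1 + 1 + 1 by ring]
    simp only [Finset.prod_range_succ]
    ring

theorem prod_ite_one_four (x : R) (M : ℕ) :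
    ∏ a ∈ Finset.range (5 * M + 1), (if a ≡ 1 [MOD 5] ∨ a ≡ 4 [MOD 5] then 1 - x ^ a else 1) =
      ∏ j ∈ Finset.range M, ((1 - x ^ (5 * j + 1)) * (1 - x ^ (5 * j + 4))) := by
  induction M with
  | zero => simp [Nat.ModEq]
  | succ M ih =>
    rw [Finset.prod_range_succ _ M, ← ih, show 5 * (M + 1) + 1 = 5 * M + 1 + 5 by ring,
      Finset.prod_range_add]
    congr 1
    simp [Finset.prod_range_succ, add_assoc, Nat.ModEq]

theorem prod_ite_two_three (x : R) (M : ℕ) :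
    ∏ a ∈ Finset.range (5 * M + 1), (if a ≡ 2 [MOD 5] ∨ a ≡ 3 [MOD 5] then 1 - x ^ a else 1) =
      ∏ j ∈ Finset.range M, ((1 - x ^ (5 * j + 2)) * (1 - x ^ (5 * j + 3))) := by
  induction M with
  | zero => simp [Nat.ModEq]
  | succ M ih =>
    rw [Finset.prod_range_succ _ M, ← ih, show 5 * (M + 1) + 1 = 5 * M + 1 + 5 by ring,
      Finset.prod_range_add]
    congr 1
    simp [Finset.prod_range_succ, add_assoc, Nat.ModEq]

/-- Only the empty word qualifies. This is the initial value that normalises the recurrence. -/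
theorem wordSeries_self (s : ℕ) : wordSeries (fun a => s + 1 ≤ a) (· + 2) (s + 1) = 1 := by
  have h : ∀ m, m ≤ s + 1 → wordSeries (fun a => s + 1 ≤ a) (· + 2) m = 1 := by
    intro m
    induction m with
    | zero => exact fun _ => wordSeries_zero _ _
    | succ m ih =>
      intro hm
      rw [wordSeries_succ_of_not_mem _ (by lia), ih (by lia)]
  exact h _ le_rfl

theorem ramanujanSum_eq_mul_wordSeries (f : PowerSeries ℤ →+* R) {N : ℕ}
    (hf : f PowerSeries.X ^ N = 0) {s m : ℕ} (hm : N ≤ m) (hs : s ≤ m) :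
    ramanujanSum (f PowerSeries.X) N m = ramanujanSum (f PowerSeries.X) N s *
      f (wordSeries (fun a => s + 1 ≤ a) (· + 2) (m + 1)) := by
  have h := mul_eq_mul_of_rec hf
    (f := fun i => f (wordSeries (fun a => s + 1 ≤ a) (· + 2) (i + 1)))
    (g := ramanujanSum (f PowerSeries.X) N) (s := s) ?_ (fun i _ => ramanujanSum_rec hf i) hm hs
  · simpa only [wordSeries_self, map_one, one_mul] using h
  · intro i hi
    have h := wordSeries_succ_of_mem (S := fun a => s + 1 ≤ a) (· + 2) (Nat.succ_pos i)
      (Nat.succ_le_succ hi)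
    simp only [Nat.succ_eq_add_one] at h
    simp only [← map_pow, ← map_mul, ← map_add, h]
    rw [show i + 2 + 1 = i + 1 + 2 by ring, sub_add_cancel]

theorem map_wordSeries_one_eq (f : PowerSeries ℤ →+* R) {K : ℕ} (hK : 0 < K)
    (hf : f PowerSeries.X ^ K = 0) :
    f (wordSeries (fun a => 1 ≤ a) (· + 2) (5 * (2 * K) + 1)) =
      f (wordSeries (fun a => a ≡ 1 [MOD 5] ∨ a ≡ 4 [MOD 5]) id (5 * (2 * K) + 1)) := by
  rw [wordSeries_id_eq_prod (fun a ha => by by_contra h; simp_all [Nat.ModEq]),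
    prod_ite_one_four, map_prod]
  have hf2 : f PowerSeries.X ^ (2 * K) = 0 := pow_eq_zero_of_le (by lia) hf
  -- A multiple of 5 as upper index makes the Euler product split evenly into residue classes, with
  -- the same range `2 * K` as the triple product, whose factors then cancel as units.
  have h := ramanujanSum_eq_mul_wordSeries f hf2 (s := 0) (m := 5 * (2 * K)) (by lia) (by lia)
  rw [ramanujanSum_eq_qFactorial (by lia) hf2 (by lia), prod_range_five_mul,
    ramanujanSum_zero_eq_prod hK hf] at h
  refine IsUnit.mul_left_cancel (IsUnit.prod_iff.2 fun j _ => ?_) (h.symm.trans ?_)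
  · exact ((isUnit_one_sub_pow hf (by lia)).mul (isUnit_one_sub_pow hf (by lia))).mul
      (isUnit_one_sub_pow hf (by lia))
  · rw [← Finset.prod_mul_distrib]
    refine Finset.prod_congr rfl fun j _ => ?_
    simp only [map_mul, map_sub, map_one, map_pow]
    ring

theorem map_wordSeries_two_eq (f : PowerSeries ℤ →+* R) {K : ℕ} (hK : 0 < K)
    (hf : f PowerSeries.X ^ K = 0) :
    f (wordSeries (fun a => 2 ≤ a) (· + 2) (5 * (2 * K) + 1)) =
      f (wordSeries (fun a => a ≡ 2 [MOD 5] ∨ a ≡ 3 [MOD 5]) id (5 * (2 * K) + 1)) := by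
  rw [wordSeries_id_eq_prod (fun a ha => by by_contra h; simp_all [Nat.ModEq]),
    prod_ite_two_three, map_prod]
  have hf2 : f PowerSeries.X ^ (2 * K) = 0 := pow_eq_zero_of_le (by lia) hf
  have h := ramanujanSum_eq_mul_wordSeries f hf2 (s := 1) (m := 5 * (2 * K)) (by lia) (by lia)
  rw [ramanujanSum_eq_qFactorial (by lia) hf2 (by lia), prod_range_five_mul,
    ramanujanSum_one_eq_prod hK hf] at h
  refine IsUnit.mul_left_cancel (IsUnit.prod_iff.2 fun j _ => ?_) (h.symm.trans ?_)
  · exact ((isUnit_one_sub_pow hf (by lia)).mul (isUnit_one_sub_pow hf (by lia))).mul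
      (isUnit_one_sub_pow hf (by lia))
  · rw [← Finset.prod_mul_distrib]
    refine Finset.prod_congr rfl fun j _ => ?_
    simp only [map_mul, map_sub, map_one, map_pow]
    ring

end RogersRamanujan

/-! ### From truncated power series back to counting compositions. -/

section Compositions

theorem coeff_eq_of_mk_eq {φ ψ : PowerSeries ℤ} {n K : ℕ} (hn : n < K)
    (h : Ideal.Quotient.mk (Ideal.span {PowerSeries.X ^ K}) φ =
      Ideal.Quotient.mk (Ideal.span {PowerSeries.X ^ K}) ψ) :
    PowerSeries.coeff n φ = PowerSeries.coeff n ψ := by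
  rw [Ideal.Quotient.eq, Ideal.mem_span_singleton, PowerSeries.X_pow_dvd_iff] at h
  simpa [sub_eq_zero] using h n hn

theorem mk_X_pow_eq_zero (K : ℕ) :
    Ideal.Quotient.mk (Ideal.span {(PowerSeries.X : PowerSeries ℤ) ^ K}) PowerSeries.X ^ K = 0 := by
  rw [← map_pow, Ideal.Quotient.eq_zero_iff_mem]
  exact Ideal.mem_span_singleton_self _

theorem sum_Icc_neg_one_pow_mul_card {n : ℕ} (hn : 1 ≤ n) (P : Composition n → Prop)
    [DecidablePred P] :
    ∑ k ∈ Finset.Icc 1 n, (-1 : ℤ) ^ k * ((Finset.univ.filter fun κ => κ.length = k ∧ P κ).card : ℤ)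
      = ∑ κ : Composition n with P κ, (-1) ^ κ.length := by
  rw [← Finset.sum_fiberwise_of_maps_to (s := Finset.univ.filter P) (t := Finset.Icc 1 n)
    (g := Composition.length)]
  · refine Finset.sum_congr rfl fun k _ => ?_
    rw [Finset.filter_filter, Finset.sum_congr rfl (g := fun _ => (-1 : ℤ) ^ k)]
    · rw [Finset.sum_const, nsmul_eq_mul, mul_comm]
      simp only [and_comm]
    · intro κ hκ
      rw [(Finset.mem_filter.1 hκ).2.2]
  · intro κ _
    exact Finset.mem_Icc.2 ⟨κ.length_pos_of_pos (by lia), κ.length_le⟩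

theorem sum_filter_and_not_eq_zero {n : ℕ} (P Q : Composition n → Prop) [DecidablePred P]
    [DecidablePred Q] (hQP : ∀ κ, Q κ → P κ)
    (h : ∑ κ with P κ, (-1 : ℤ) ^ κ.length = ∑ κ with Q κ, (-1) ^ κ.length) :
    ∑ κ with P κ ∧ ¬ Q κ, (-1 : ℤ) ^ κ.length = 0 := by
  rw [← Finset.sum_filter_add_sum_filter_not _ Q, Finset.filter_filter, Finset.filter_filter] at h
  have e : (Finset.univ.filter fun κ => P κ ∧ Q κ) = Finset.univ.filter Q :=
    Finset.filter_congr fun κ _ => and_iff_right_of_imp (hQP κ)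
  rw [e] at h
  linarith

theorem IsStrictlyDecreasing.risingsAtMost {n : ℕ} {κ : Composition n}
    (h : IsStrictlyDecreasing κ) (m : ℕ) : RisingsAtMost m κ :=
  List.IsChain.imp (fun _ _ hab => by lia) h

theorem sum_risingsAtMost_one (n : ℕ) :
    ∑ κ : Composition n with RisingsAtMost 1 κ, (-1 : ℤ) ^ κ.length =
      ∑ κ : Composition n with IsStrictlyDecreasing κ ∧ PartsCongruentModFive 1 4 κ,
        (-1) ^ κ.length := by
  -- Truncating at `X ^ (n + 1)` keeps the coefficient of `X ^ n`, and the bound on the first part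
  -- exceeds `n`, so it is vacuous.
  have h := coeff_eq_of_mk_eq (Nat.lt_succ_self n)
    (map_wordSeries_one_eq _ (Nat.succ_pos n) (mk_X_pow_eq_zero (n + 1)))
  rw [coeff_wordSeries_of_lt (P := fun κ => RisingsAtMost 1 κ) (by lia) ?_,
    coeff_wordSeries_of_lt (t := id) (P := fun κ => IsStrictlyDecreasing κ ∧
      PartsCongruentModFive 1 4 κ)
      (by lia) fun κ => and_comm] at h
  · exact h
  · intro κ
    rw [RisingsAtMost, List.IsChain.iff fun a b => (Nat.lt_succ_iff (m := b) (n := a + 1)).symm]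
    exact (and_iff_right fun a ha => κ.blocks_pos ha).symm

theorem sum_risingsAtMost_one_of_two_le (n : ℕ) :
    ∑ κ : Composition n with RisingsAtMost 1 κ ∧ ∀ a ∈ κ.blocks, 2 ≤ a, (-1 : ℤ) ^ κ.length =
      ∑ κ : Composition n with IsStrictlyDecreasing κ ∧ PartsCongruentModFive 2 3 κ,
        (-1) ^ κ.length := by
  have h := coeff_eq_of_mk_eq (Nat.lt_succ_self n)
    (map_wordSeries_two_eq _ (Nat.succ_pos n) (mk_X_pow_eq_zero (n + 1)))
  rw [coeff_wordSeries_of_lt (P := fun κ => RisingsAtMost 1 κ ∧ ∀ a ∈ κ.blocks, 2 ≤ a) (by lia) ?_,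
    coeff_wordSeries_of_lt (t := id) (P := fun κ => IsStrictlyDecreasing κ ∧
      PartsCongruentModFive 2 3 κ)
      (by lia) fun κ => and_comm] at h
  · exact h
  · intro κ
    rw [RisingsAtMost, List.IsChain.iff fun a b => (Nat.lt_succ_iff (m := b) (n := a + 1)).symm]
    exact and_comm

theorem PartsCongruentModFive.two_le {n : ℕ} {κ : Composition n}
    (h : PartsCongruentModFive 2 3 κ) : ∀ a ∈ κ.blocks, 2 ≤ a := by
  intro a ha
  have := h a ha
  simp only [Nat.ModEq] at this
  lia

end Compositions

theorem mainTheorem4 :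
    (∀ n : ℕ, 1 ≤ n →
      ∑ k ∈ Finset.Icc 1 n, (-1 : ℤ) ^ k * ((hatCompOne n k).card : ℤ) = 0) ∧
    (∀ n : ℕ, 2 ≤ n →
      ∑ k ∈ Finset.Icc 1 n, (-1 : ℤ) ^ k * ((hatShiftCompOne n k).card : ℤ) = 0) := by
  constructor
  · intro n hn
    simp only [hatCompOne, compOne, Finset.filter_filter, and_assoc]
    rw [sum_Icc_neg_one_pow_mul_card hn]
    exact sum_filter_and_not_eq_zero _ _ (fun κ h => h.1.risingsAtMost 1) (sum_risingsAtMost_one n)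
  · intro n hn
    simp only [hatShiftCompOne, shiftCompOne, compOne, Finset.filter_filter, and_assoc]
    rw [sum_Icc_neg_one_pow_mul_card (by lia)]
    simp only [← and_assoc (a := RisingsAtMost 1 _)]
    exact sum_filter_and_not_eq_zero _ _ (fun κ h => ⟨h.1.risingsAtMost 1, h.2.two_le⟩)
      (sum_risingsAtMost_one_of_two_le n)
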